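/- In bin packing, an input $I$ is a finite sequence of items with rational sizes in $(0,1]$; a packing partitions the items into bins so that the total size of the items in each bin is at most $1$, and $OPT(I)$ denotes the minimum number of bins in a packing of $I$. In bin packing with known optimal cost (K-O), an online algorithm is told the number $OPT(I)$ before the first item arrives; the items of $I$ then arrive one by one, and each has to be assigned irrevocably to a bin before anything about the later items is revealed. For a deterministic online algorithm $A$ for K-O, let $A(I)$ be the number of bins that $A$ uses for $I$. The (asymptotic) competitive ratio of $A$ is $$R_A=\limsup_{Q\to\infty}\ \frac{1}{Q}\,\sup\{A(I) : OPT(I)=Q\}\in[0,\infty].$$ **Theorem.** Every deterministic online algorithm $A$ for K-O satisfies $R_A\ge \frac{87}{62}\approx 1.4032258$. -/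

import Mathlib

namespace BinPacking

/-- An item, given by its size, a rational number in `(0, 1]`. -/
abbrev Item : Type := Set.Ioc (0 : ℚ) 1

/-- An input: a finite sequence of items, in order of arrival. -/
abbrev Input : Type := List Item

/-- `f` assigns to each item of `I` the label of its bin. It is a packing if the total size of
the items in every bin is at most `1`. -/
def IsPacking (I : Input) (f : Fin I.length → ℕ) : Prop :=
  ∀ b : ℕ, ∑ i with f i = b, (I.get i : ℚ) ≤ 1

/-- The number of (non-empty) bins used by an assignment of `n` items to bins. -/
def binsUsed {n : ℕ} (f : Fin n → ℕ) : ℕ :=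
  (Finset.univ.image f).card

/-- The optimal offline cost: the minimum number of bins in a packing of `I`. -/
noncomputable def opt (I : Input) : ℕ :=
  sInf {m : ℕ | ∃ f : Fin I.length → ℕ, IsPacking I f ∧ binsUsed f = m}

/-- A deterministic online algorithm for bin packing with known optimal cost. -/
structure KnownOptAlgorithm where
  /-- `place Q past x` is the label of the bin that receives the new item `x`, given the announced
  optimal cost `Q` and the sequence `past` of the items that arrived before `x`. (The earlier
  decisions of the algorithm are determined by `Q` and `past`.) -/
  place : ℕ → List Item → Item → ℕ
  /-- On every input whose optimal cost is announced correctly, the algorithm produces a packing. -/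
  feasible : ∀ I : Input,
    IsPacking I (fun i => place (opt I) (I.take i) (I.get i))

namespace KnownOptAlgorithm

/-- The number of bins used by the algorithm `A` on the input `I`, where the optimal cost of `I`
is announced in advance. -/
noncomputable def cost (A : KnownOptAlgorithm) (I : Input) : ℕ :=
  binsUsed (fun i : Fin I.length => A.place (opt I) (I.take i) (I.get i))

open scoped ENNReal in
/-- The largest cost (possibly `∞`) of `A` over all inputs with optimal cost `Q`. -/
noncomputable def worstCost (A : KnownOptAlgorithm) (Q : ℕ) : ℝ≥0∞ :=
  ⨆ I ∈ {I : Input | opt I = Q}, (A.cost I : ℝ≥0∞)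

open scoped ENNReal in
/-- The asymptotic competitive ratio of `A`, an element of `[0, ∞]`. -/
noncomputable def competitiveRatio (A : KnownOptAlgorithm) : ℝ≥0∞ :=
  Filter.limsup (fun Q : ℕ => A.worstCost Q / (Q : ℝ≥0∞)) Filter.atTop

end KnownOptAlgorithm

end BinPacking

/-!
An adversary releases `Q` tiny items of sizes just above `1 / 8`, and continues in one of several
ways, all of which keep the optimal cost at most `Q`. As every input can be padded to optimal cost
exactly `Q`, the algorithm must use at most `c` bins after each continuation.

The excess of an item over `1 / 8` is chosen depending on the previous decisions, so that every item
that opens a bin has an excess of at least `4 * α` while all the others have an excess of at most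
`α`. Hence there are items that fit on top of any small item but into none of the bins in use.

Let `N k` be the number of bins that contain at least `k` tiny items. The continuations are
* items of size `7 / 8 - α`, which bound the number `N 1` of bins;
* `Q` medium items just above `9 / 25`, again with an adaptive excess, with `β` in place of `α`,
  followed by items of size `1`, `101 / 200` or `16 / 25 - β`, which bound `N 3 + N 6` and
  `2 * N 3 + N 6`;
* `19 / 20 * Q` items of size `3 / 8 - 3 / 2 * α`, followed by items of size `7 / 8 - α` or
  `1 / 2 + α / 2`, which bound `N 2 + N 5`.

No bin holds more than seven tiny items, so `N 1 + ⋯ + N 7 = Q`, and a linear combination of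
these bounds gives `c ≥ 2513 / 1790 * Q - O(1)`.
-/

namespace BinPacking

theorem exists_eq_add_card_eq {α : Type*} {s : Multiset α} {k : ℕ} (h : k ≤ s.card) :
    ∃ t u, s = t + u ∧ t.card = k := by
  induction s using Quotient.inductionOn with
  | _ l => exact ⟨l.take k, l.drop k, by simp, by simpa using h⟩

theorem exists_map_fiber_eq {ι κ α : Type*} [Fintype ι] [DecidableEq ι] [Nonempty ι]
    (v : κ → α) (s : Finset κ) {g : ι → Multiset α} (hg : ∑ i, g i = s.val.map v) :
    ∃ f : κ → ι, ∀ i, (s.filter fun k ↦ f k = i).val.map v = g i := by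
  classical
  induction s using Finset.induction_on generalizing g with
  | empty =>
    refine ⟨fun _ ↦ Classical.arbitrary ι, fun i ↦ ?_⟩
    simpa using (Finset.sum_eq_zero_iff.1 (hg.trans (by simp)) i (Finset.mem_univ i)).symm
  | insert a s ha ih =>
    rw [Finset.insert_val_of_notMem ha, Multiset.map_cons] at hg
    obtain ⟨j, -, hj⟩ := Multiset.mem_sum.1 (hg ▸ Multiset.mem_cons_self (v a) _)
    obtain ⟨t, ht⟩ := Multiset.exists_cons_of_mem hj
    have hsum : ∑ i, Function.update g j t i = s.val.map v := by
      rwa [← Finset.add_sum_erase _ _ (Finset.mem_univ j), ht, Multiset.cons_add,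
        ← Finset.sdiff_singleton_eq_erase, ← Finset.sum_update_of_mem (Finset.mem_univ j),
        Multiset.cons_inj_right] at hg
    obtain ⟨f, hf⟩ := ih hsum
    refine ⟨Function.update f a j, fun i ↦ ?_⟩
    have hs : (s.filter fun k ↦ Function.update f a j k = i) = s.filter fun k ↦ f k = i :=
      Finset.filter_congr fun k hk ↦ by
        rw [Function.update_of_ne (ne_of_mem_of_not_mem hk ha)]
    rw [Finset.filter_insert, Function.update_self, hs]
    obtain rfl | hij := eq_or_ne j i
    · rw [if_pos rfl, Finset.insert_val_of_notMem (by simp [ha]), Multiset.map_cons, hf,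
        Function.update_self, ht]
    · rw [if_neg hij, hf, Function.update_of_ne hij.symm]

/-- The multiset `s` can be distributed over `n` bins of capacity `q`. The capacity is a parameter
so that bins can be filled layer by layer, see `PackableIn.superpose`. -/
def PackableIn (s : Multiset ℚ) (n : ℕ) (q : ℚ) : Prop :=
  ∃ g : Fin n → Multiset ℚ, ∑ i, g i = s ∧ ∀ i, (g i).sum ≤ q

namespace PackableIn

variable {s t : Multiset ℚ} {n m : ℕ} {q r u : ℚ}

theorem mono (h : PackableIn s n q) (hqr : q ≤ r) : PackableIn s n r :=
  h.imp fun _ hg ↦ ⟨hg.1, fun i ↦ (hg.2 i).trans hqr⟩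

theorem superpose (hs : PackableIn s n q) (ht : PackableIn t n r) :
    PackableIn (s + t) n (q + r) := by
  obtain ⟨g, rfl, hg⟩ := hs
  obtain ⟨g', rfl, hg'⟩ := ht
  refine ⟨g + g', Finset.sum_add_distrib, fun i ↦ ?_⟩
  rw [Pi.add_apply, Multiset.sum_add]
  exact add_le_add (hg i) (hg' i)

theorem juxtapose (hs : PackableIn s n q) (ht : PackableIn t m q) :
    PackableIn (s + t) (n + m) q := by
  obtain ⟨g, rfl, hg⟩ := hs
  obtain ⟨g', rfl, hg'⟩ := ht
  exact ⟨Fin.append g g', by simp [Fin.sum_univ_add], Fin.addCases (by simpa) (by simpa)⟩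

theorem zero (hq : 0 ≤ q) : PackableIn 0 n q := ⟨0, by simp, fun _ ↦ by simpa⟩

theorem of_sum_le (h : s.sum ≤ q) : PackableIn s 1 q := ⟨fun _ ↦ s, by simp, fun _ ↦ h⟩

theorem mono_bins (h : PackableIn s n q) (hq : 0 ≤ q) (hnm : n ≤ m) : PackableIn s m q := by
  simpa [Nat.add_sub_cancel' hnm] using h.juxtapose (zero (n := m - n) hq)

theorem sum_le (h : PackableIn s n q) : s.sum ≤ n * q := by
  obtain ⟨g, rfl, hg⟩ := h
  calc (∑ i, g i).sum = ∑ i, (g i).sum := Multiset.sum_sum g _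
    _ ≤ ∑ _i : Fin n, q := Finset.sum_le_sum fun i _ ↦ hg i
    _ = n * q := by simp

theorem of_finset {ι : Type*} (U : Finset ι) {g : ι → Multiset ℚ}
    (hg : ∀ b ∈ U, (g b).sum ≤ q) : PackableIn (∑ b ∈ U, g b) U.card q := by
  refine ⟨fun i ↦ g (U.equivFin.symm i), ?_, fun i ↦ hg _ (U.equivFin.symm i).2⟩
  rw [U.equivFin.symm.sum_comp fun b : U ↦ g b, Finset.sum_coe_sort U g]

theorem of_card_le_mul (hu : 0 ≤ u) (c : ℕ) (hs : ∀ x ∈ s, x ≤ u) (hc : s.card ≤ c * n) :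
    PackableIn s n (c * u) := by
  induction n generalizing s with
  | zero =>
    obtain rfl : s = 0 := by simpa using hc
    exact zero (by positivity)
  | succ n ih =>
    obtain ⟨t, r, rfl, ht⟩ := exists_eq_add_card_eq (min_le_right c s.card)
    have htsum : t.sum ≤ c * u := by
      calc t.sum ≤ t.card • u :=
            t.sum_le_card_nsmul u fun x hx ↦ hs x (Multiset.mem_add.2 (.inl hx))
        _ ≤ c • u := nsmul_le_nsmul_left hu (by omega)
        _ = c * u := nsmul_eq_mul c u
    have hr : r.card ≤ c * n := by
      rw [Multiset.card_add] at hc ht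
      rw [mul_add_one] at hc
      omega
    rw [add_comm]
    exact (ih (fun x hx ↦ hs x (Multiset.mem_add.2 (.inr hx))) hr).juxtapose (of_sum_le htsum)

theorem of_card_le (hu : 0 ≤ u) (hs : ∀ x ∈ s, x ≤ u) (hc : s.card ≤ n) : PackableIn s n u := by
  simpa using of_card_le_mul hu 1 hs (by simpa using hc)

theorem replicate_mul (hu : 0 ≤ u) (c n : ℕ) :
    PackableIn (Multiset.replicate (c * n) u) n (c * u) :=
  of_card_le_mul hu c (fun _ hx ↦ (Multiset.eq_of_mem_replicate hx).le) (by simp)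

theorem replicate (hu : 0 ≤ u) (n : ℕ) : PackableIn (Multiset.replicate n u) n u := by
  simpa using replicate_mul hu 1 n

end PackableIn

/-- The multiset of item sizes of an input, on which alone the packability depends. -/
def sizes (I : Input) : Multiset ℚ := (I : Multiset Item).map (↑)

theorem sizes_cons (x : Item) (I : Input) : sizes (x :: I) = (x : ℚ) ::ₘ sizes I := rfl

theorem sizes_append (I J : Input) : sizes (I ++ J) = sizes I + sizes J := by
  simp [sizes, ← Multiset.coe_add]

theorem sizes_replicate (n : ℕ) (x : Item) :
    sizes (List.replicate n x) = Multiset.replicate n (x : ℚ) := by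
  rw [sizes, Multiset.coe_replicate, Multiset.map_replicate]

theorem card_sizes (I : Input) : (sizes I).card = I.length := by simp [sizes]

theorem mem_Ioc_of_mem_sizes {I : Input} {x : ℚ} (hx : x ∈ sizes I) : x ∈ Set.Ioc (0 : ℚ) 1 := by
  obtain ⟨y, -, rfl⟩ := Multiset.mem_map.1 hx
  exact y.2

theorem sizes_eq_map_get (I : Input) :
    sizes I = (Finset.univ : Finset (Fin I.length)).val.map fun i ↦ (I.get i : ℚ) := by
  conv_lhs => rw [← List.ofFn_get I]
  rw [sizes, List.ofFn_eq_map, ← Multiset.map_coe, Multiset.map_map]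
  rfl

theorem packableIn_of_isPacking {I : Input} {f : Fin I.length → ℕ} (hf : IsPacking I f) :
    PackableIn (sizes I) (binsUsed f) 1 := by
  have hsum : ∑ b ∈ Finset.univ.image f, ∑ i with f i = b, {(I.get i : ℚ)} = sizes I := by
    rw [Finset.sum_fiberwise_of_maps_to fun i _ ↦ Finset.mem_image_of_mem f (Finset.mem_univ i),
      sizes_eq_map_get, ← Multiset.sum_map_singleton (Multiset.map _ _), Multiset.map_map]
    rfl
  rw [← hsum]
  refine PackableIn.of_finset _ fun b _ ↦ ?_
  rw [Multiset.sum_sum]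
  simpa only [Multiset.sum_singleton] using hf b

theorem exists_isPacking_of_packableIn {I : Input} {n : ℕ} (h : PackableIn (sizes I) n 1) :
    ∃ f : Fin I.length → ℕ, IsPacking I f ∧ binsUsed f ≤ n := by
  obtain ⟨g, hg, hg1⟩ := h
  obtain rfl | n := n
  · obtain rfl : I = [] := List.length_eq_zero_iff.1 (by simp [← card_sizes, ← hg])
    exact ⟨Fin.elim0, by simp [IsPacking], by simp [binsUsed]⟩
  obtain ⟨f, hf⟩ := exists_map_fiber_eq _ _ (hg.trans (sizes_eq_map_get I))
  refine ⟨fun i ↦ f i, fun b ↦ ?_, ?_⟩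
  · obtain hb | hb := lt_or_ge b (n + 1)
    · calc ∑ i with (f i : ℕ) = b, (I.get i : ℚ) = ∑ i with f i = ⟨b, hb⟩, (I.get i : ℚ) := by
            simp only [Fin.ext_iff]
        _ = (g ⟨b, hb⟩).sum := congrArg Multiset.sum (hf _)
        _ ≤ 1 := hg1 _
    · rw [Finset.filter_false_of_mem fun i _ ↦ ((f i).2.trans_le hb).ne]
      simp
  · calc binsUsed (fun i ↦ (f i : ℕ)) ≤ (Finset.range (n + 1)).card :=
          Finset.card_le_card (Finset.image_subset_iff.2 fun i _ ↦ Finset.mem_range.2 (f i).2)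
      _ = n + 1 := Finset.card_range _

theorem opt_le_iff {I : Input} {n : ℕ} : opt I ≤ n ↔ PackableIn (sizes I) n 1 := by
  constructor
  · intro h
    have hpack : PackableIn (sizes I) I.length 1 :=
      PackableIn.of_card_le zero_le_one (fun x hx ↦ (mem_Ioc_of_mem_sizes hx).2) (card_sizes I).le
    obtain ⟨f₀, hf₀, -⟩ := exists_isPacking_of_packableIn hpack
    have hne : {m | ∃ f : Fin I.length → ℕ, IsPacking I f ∧ binsUsed f = m}.Nonempty :=
      ⟨_, f₀, hf₀, rfl⟩
    obtain ⟨f, hf, hfopt⟩ := Nat.sInf_mem hne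
    exact (packableIn_of_isPacking hf).mono_bins zero_le_one (hfopt.trans_le h)
  · intro h
    obtain ⟨f, hf, hfn⟩ := exists_isPacking_of_packableIn h
    have hopt : opt I ≤ binsUsed f := Nat.sInf_le ⟨f, hf, rfl⟩
    exact hopt.trans hfn

theorem packableIn_opt (I : Input) : PackableIn (sizes I) (opt I) 1 := opt_le_iff.1 le_rfl

theorem opt_append_le (I J : Input) : opt (I ++ J) ≤ opt I + opt J := by
  rw [opt_le_iff, sizes_append]
  exact (packableIn_opt I).juxtapose (packableIn_opt J)

theorem opt_singleton_le (x : Item) : opt [x] ≤ 1 :=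
  opt_le_iff.2 (PackableIn.of_sum_le (by simpa [sizes] using x.2.2))

theorem sum_sizes_le_opt (I : Input) : (sizes I).sum ≤ opt I := by
  simpa using (packableIn_opt I).sum_le

theorem exists_opt_append_eq {I : Input} {Q : ℕ} (h : opt I ≤ Q) : ∃ J, opt (I ++ J) = Q := by
  let one : Item := ⟨1, by norm_num⟩
  have of_le (k : ℕ) : Q ≤ opt (I ++ List.replicate k one) → ∃ J, opt (I ++ J) = Q := by
    induction k with
    | zero => exact fun hk ↦ ⟨[], le_antisymm (by simpa using h) hk⟩
    | succ k ih =>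
      intro hk
      obtain hQ | hQ := le_or_gt Q (opt (I ++ List.replicate k one))
      · exact ih hQ
      · refine ⟨_, le_antisymm ?_ hk⟩
        rw [List.replicate_succ', ← List.append_assoc]
        have := opt_append_le (I ++ List.replicate k one) [one]
        have := opt_singleton_le one
        omega
  refine of_le Q ?_
  have hsum := sum_sizes_le_opt (I ++ List.replicate Q one)
  rw [sizes_append, sizes_replicate, Multiset.sum_add, Multiset.sum_replicate, nsmul_one] at hsum
  have hI : 0 ≤ (sizes I).sum := Multiset.sum_nonneg fun x hx ↦ (mem_Ioc_of_mem_sizes hx).1.le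
  exact_mod_cast (le_add_of_nonneg_left hI).trans hsum

/-- A placement rule: the bin that receives a new item, given the items that arrived before it. -/
abbrev Rule : Type := List Item → Item → ℕ

/-- The contents of the bins when the rule `P` places the items of an input that arrive after the
items `past`. The items `past` themselves are not counted. -/
noncomputable def packing (P : Rule) : Input → Input → ℕ →₀ Multiset ℚ
  | _, [] => 0
  | past, x :: I => Finsupp.single (P past x) {(x : ℚ)} + packing P (past ++ [x]) I

section Packing

variable {P : Rule} {past I J : Input} {b : ℕ} {x : ℚ}

theorem packing_append :
    packing P past (I ++ J) = packing P past I + packing P (past ++ I) J := by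
  induction I generalizing past with
  | nil => simp [packing]
  | cons x I ih => simp [packing, ih, add_assoc]

theorem packing_nil_append : packing P [] (I ++ J) = packing P [] I + packing P I J :=
  packing_append

theorem support_packing_nil_append :
    (packing P [] (I ++ J)).support = (packing P [] I).support ∪ (packing P I J).support := by
  rw [packing_nil_append, Finsupp.support_add_eq_union]

theorem support_packing_append_singleton (y : Item) : (packing P [] (past ++ [y])).support =
    insert (P past y) (packing P [] past).support := by
  rw [support_packing_nil_append, packing, packing, add_zero,
    Finsupp.support_single _ (Multiset.singleton_ne_zero _), Finset.union_comm,
    Finset.insert_eq]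

theorem packing_eq_sum : packing P past I =
    ∑ i : Fin I.length, Finsupp.single (P (past ++ I.take i) (I.get i)) {(I.get i : ℚ)} := by
  induction I generalizing past with
  | nil => simp [packing]
  | cons x I ih =>
    rw [packing, ih]
    refine Eq.trans ?_ (Fin.sum_univ_succ (n := I.length) _).symm
    simp

theorem sum_packing_apply :
    (packing P past I b).sum =
      ∑ i ∈ {i : Fin I.length | P (past ++ I.take i) (I.get i) = b}, (I.get i : ℚ) := by
  rw [packing_eq_sum, Finsupp.finsetSum_apply, Multiset.sum_sum, Finset.sum_filter]
  refine Finset.sum_congr rfl fun i _ ↦ ?_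
  rw [Finsupp.single_apply]
  split_ifs <;> simp

theorem support_packing : (packing P past I).support =
    Finset.univ.image fun i : Fin I.length ↦ P (past ++ I.take i) (I.get i) := by
  ext b
  rw [Finsupp.mem_support_iff, packing_eq_sum, Finsupp.finsetSum_apply, Ne,
    Finset.sum_eq_zero_iff]
  simp [Finsupp.single_apply]

theorem sum_packing {s : Finset ℕ} (hs : (packing P past I).support ⊆ s) :
    ∑ b ∈ s, packing P past I b = sizes I := by
  rw [← Finsupp.sum_of_support_subset _ hs (fun _ t ↦ t) fun _ _ ↦ rfl]
  clear hs
  induction I generalizing past with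
  | nil => simp [packing, sizes]
  | cons x I ih =>
    rw [packing, Finsupp.sum_add_index' (fun _ ↦ rfl) fun _ _ _ ↦ rfl, ih,
      Finsupp.sum_single_index rfl, sizes_cons, Multiset.singleton_add]

theorem sum_card_packing {s : Finset ℕ} (hs : (packing P past I).support ⊆ s) :
    ∑ b ∈ s, (packing P past I b).card = I.length := by
  rw [← Multiset.card_sum, sum_packing hs, card_sizes]

theorem mem_sizes_of_mem_packing (hx : x ∈ packing P past I b) : x ∈ sizes I := by
  rw [← sum_packing (Finset.subset_insert b (packing P past I).support)]
  exact Multiset.mem_sum.2 ⟨b, Finset.mem_insert_self _ _, hx⟩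

theorem sum_packing_apply_nonneg : 0 ≤ (packing P past I b).sum :=
  Multiset.sum_nonneg fun _ hx ↦ (mem_Ioc_of_mem_sizes (mem_sizes_of_mem_packing hx)).1.le

theorem card_packing_mul_le_sum {u : ℚ} (hI : ∀ x ∈ sizes I, u ≤ x) :
    (packing P past I b).card * u ≤ (packing P past I b).sum := by
  rw [← nsmul_eq_mul]
  exact Multiset.card_nsmul_le_sum fun x hx ↦ hI x (mem_sizes_of_mem_packing hx)

theorem card_packing_sub_one_mul_add_le_sum {u : ℚ} (hI : ∀ x ∈ sizes I, u ≤ x)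
    (hx : x ∈ packing P past I b) :
    ((packing P past I b).card - 1) * u + x ≤ (packing P past I b).sum := by
  obtain ⟨t, ht⟩ := Multiset.exists_cons_of_mem hx
  have hsum : t.card • u ≤ t.sum := Multiset.card_nsmul_le_sum fun y hy ↦
    hI y (mem_sizes_of_mem_packing (ht ▸ Multiset.mem_cons_of_mem hy))
  rw [ht, Multiset.sum_cons, Multiset.card_cons]
  rw [nsmul_eq_mul] at hsum
  push_cast
  linarith

end Packing

/-- The bins of the packing `p` that are in use and cannot receive an item of size `w`. -/
def closedBins (p : ℕ →₀ Multiset ℚ) (w : ℚ) : Finset ℕ :=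
  p.support.filter fun b ↦ 1 < (p b).sum + w

/-- The rule `P` packs every input that fits into `Q` bins feasibly, into at most `c` bins. -/
def PacksWithin (P : Rule) (Q c : ℕ) : Prop :=
  ∀ I, PackableIn (sizes I) Q 1 →
    (∀ b, (packing P [] I b).sum ≤ 1) ∧ (packing P [] I).support.card ≤ c

theorem KnownOptAlgorithm.packsWithin_place (A : KnownOptAlgorithm) {Q c : ℕ}
    (h : ∀ I, opt I = Q → A.cost I ≤ c) : PacksWithin (A.place Q) Q c := by
  intro I hI
  obtain ⟨J, rfl⟩ := exists_opt_append_eq (opt_le_iff.2 hI)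
  constructor
  · intro b
    have hb : (packing (A.place (opt (I ++ J))) [] (I ++ J) b).sum ≤ 1 :=
      sum_packing_apply.trans_le (A.feasible (I ++ J) b)
    rw [packing_nil_append, Finsupp.add_apply, Multiset.sum_add] at hb
    exact (le_add_of_nonneg_right sum_packing_apply_nonneg).trans hb
  · have hcost : (packing (A.place (opt (I ++ J))) [] (I ++ J)).support.card = A.cost (I ++ J) :=
      congrArg Finset.card support_packing
    rw [support_packing_nil_append] at hcost
    exact (Finset.card_le_card Finset.subset_union_left).trans (hcost.trans_le (h _ rfl))

namespace PacksWithin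

variable {P : Rule} {Q c t : ℕ} {I : Input} {w : Item}

theorem sum_packing_le_one (h : PacksWithin P Q c) (hI : PackableIn (sizes I) Q 1) (b : ℕ) :
    (packing P [] I b).sum ≤ 1 :=
  (h I hI).1 b

theorem card_closedBins_add_le (h : PacksWithin P Q c) (hw : 1 / 2 < (w : ℚ))
    (hI : PackableIn (sizes I + Multiset.replicate t (w : ℚ)) Q 1) :
    (closedBins (packing P [] I) w).card + t ≤ c := by
  rw [← sizes_replicate, ← sizes_append] at hI
  obtain ⟨hsum, hcard⟩ := h _ hI
  simp only [packing_nil_append, Finsupp.add_apply, Multiset.sum_add] at hsum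
  rw [support_packing_nil_append] at hcard
  set p := packing P [] I
  set q := packing P I (List.replicate t w)
  have hq (b) : (q b).card * (w : ℚ) ≤ (q b).sum := card_packing_mul_le_sum fun x hx ↦
    (Multiset.eq_of_mem_replicate (sizes_replicate t w ▸ hx)).ge
  have hq_card (b) : (q b).card ≤ 1 := by
    by_contra! hb
    have : (2 : ℚ) ≤ (q b).card := by exact_mod_cast hb
    have : 0 ≤ (p b).sum := sum_packing_apply_nonneg
    nlinarith [hsum b, hq b]
  have ht : t ≤ q.support.card := by
    calc t = ∑ b ∈ q.support, (q b).card := by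
          rw [sum_card_packing subset_rfl, List.length_replicate]
      _ ≤ q.support.card := by simpa using Finset.sum_le_sum fun b _ ↦ hq_card b
  have hdisj : Disjoint (closedBins p w) q.support := by
    refine Finset.disjoint_left.2 fun b hb hbq ↦ ?_
    have : (1 : ℚ) ≤ (q b).card := by
      exact_mod_cast Multiset.card_pos.2 (Finsupp.mem_support_iff.1 hbq)
    have := (Finset.mem_filter.1 hb).2
    nlinarith [hsum b, hq b]
  calc (closedBins p w).card + t ≤ (closedBins p w ∪ q.support).card := by
        rw [Finset.card_union_of_disjoint hdisj]
        gcongr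
    _ ≤ (p.support ∪ q.support).card :=
        Finset.card_le_card (Finset.union_subset_union_left (Finset.filter_subset _ _))
    _ ≤ c := hcard

theorem card_support_add_le (h : PacksWithin P Q c) (hw : 1 / 2 < (w : ℚ))
    (hI : PackableIn (sizes I + Multiset.replicate t (w : ℚ)) Q 1)
    (hclosed : ∀ b ∈ (packing P [] I).support, 1 < (packing P [] I b).sum + w) :
    (packing P [] I).support.card + t ≤ c := by
  have := h.card_closedBins_add_le hw hI
  rwa [closedBins, Finset.filter_true_of_mem hclosed] at this

end PacksWithin

/-- After the items `past`, the items `I` have sizes in `(u, u + ε]`, and they are large, of size at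
least `u + 4 * α`, if they open a new bin and small, of size at most `u + α`, otherwise. -/
structure IsAdaptiveStage (P : Rule) (past I : Input) (u α ε : ℚ) : Prop where
  pos : 0 < α
  four_mul_le : 4 * α ≤ ε
  mem_Ioc : ∀ x ∈ sizes I, x ∈ Set.Ioc u (u + ε)
  card_support : (packing P [] (past ++ I)).support.card =
    (packing P [] past).support.card + ((sizes I).filter (u + α < ·)).card
  exists_large : ∀ b ∈ (packing P [] (past ++ I)).support, b ∉ (packing P [] past).support →
    ∃ x ∈ packing P past I b, u + 4 * α ≤ x

namespace IsAdaptiveStage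

variable {P : Rule} {past I : Input} {u α ε : ℚ} {x : Item} {b : ℕ}

theorem nil (hα : 0 < α) (hε : 4 * α ≤ ε) : IsAdaptiveStage P past [] u α ε where
  pos := hα
  four_mul_le := hε
  mem_Ioc := by simp [sizes]
  card_support := by simp [sizes]
  exists_large := by simp_all

theorem mono {ε' : ℚ} (h : IsAdaptiveStage P past I u α ε) (hε : ε ≤ ε') :
    IsAdaptiveStage P past I u α ε' where
  __ := h
  four_mul_le := h.four_mul_le.trans hε
  mem_Ioc x hx := Set.Ioc_subset_Ioc_right (by gcongr) (h.mem_Ioc x hx)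

theorem cons_small (h : IsAdaptiveStage P (past ++ [x]) I u α ε)
    (hx : (x : ℚ) ∈ Set.Ioc u (u + α)) (hold : P past x ∈ (packing P [] past).support) :
    IsAdaptiveStage P past (x :: I) u α ε := by
  have hsupp := support_packing_append_singleton (P := P) (past := past) x
  rw [Finset.insert_eq_of_mem hold] at hsupp
  have hcard := h.card_support
  have hlarge := h.exists_large
  rw [List.append_assoc, List.singleton_append, hsupp] at hcard hlarge
  refine ⟨h.pos, h.four_mul_le, fun y hy ↦ ?_, ?_, fun b hb hb' ↦ ?_⟩
  · rw [sizes_cons, Multiset.mem_cons] at hy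
    obtain rfl | hy := hy
    · exact ⟨hx.1, hx.2.trans (by linarith [h.pos, h.four_mul_le])⟩
    · exact h.mem_Ioc y hy
  · rw [sizes_cons, Multiset.filter_cons_of_neg _ hx.2.not_gt, hcard]
  · obtain ⟨y, hy, hy'⟩ := hlarge b hb hb'
    exact ⟨y, Multiset.mem_add.2 (.inr hy), hy'⟩

theorem cons_large (h : IsAdaptiveStage P (past ++ [x]) I u α ε)
    (hx : (x : ℚ) ∈ Set.Icc (u + 4 * α) (u + ε))
    (hnew : P past x ∉ (packing P [] past).support) :
    IsAdaptiveStage P past (x :: I) u α ε := by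
  have hα := h.pos
  have hsupp := support_packing_append_singleton (P := P) (past := past) x
  have hcard := h.card_support
  have hlarge := h.exists_large
  rw [List.append_assoc, List.singleton_append, hsupp] at hcard hlarge
  refine ⟨h.pos, h.four_mul_le, fun y hy ↦ ?_, ?_, fun b hb hb' ↦ ?_⟩
  · rw [sizes_cons, Multiset.mem_cons] at hy
    obtain rfl | hy := hy
    · exact ⟨lt_of_lt_of_le (by linarith) hx.1, hx.2⟩
    · exact h.mem_Ioc y hy
  · rw [Finset.card_insert_of_notMem hnew] at hcard
    rw [sizes_cons, Multiset.filter_cons_of_pos _ (lt_of_lt_of_le (by linarith) hx.1),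
      Multiset.card_cons, hcard]
    ring
  · by_cases hbx : b = P past x
    · subst hbx
      exact ⟨x, by simp [packing], hx.1⟩
    · obtain ⟨y, hy, hy'⟩ := hlarge b hb (by simp [hbx, hb'])
      exact ⟨y, Multiset.mem_add.2 (.inr hy), hy'⟩

end IsAdaptiveStage

theorem exists_isAdaptiveStage_of_mul_le (P : Rule) {u lo hi : ℚ} (n : ℕ) (past : Input)
    (hu : 0 ≤ u) (hlo : 0 < lo) (hlohi : lo * 4 ^ 2 ^ n ≤ hi) (hhi : u + hi ≤ 1) :
    ∃ I α, I.length = n ∧ lo ≤ α ∧ IsAdaptiveStage P past I u α hi := by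
  induction n generalizing past lo hi with
  | zero => exact ⟨[], lo, rfl, le_rfl, .nil hlo (by norm_num at hlohi; linarith)⟩
  | succ n ih =>
    -- The next item exceeds `u` by the geometric mean `δ` of `lo` and `lo * 4 ^ 2 ^ (n + 1)`.
    set δ := lo * 4 ^ 2 ^ n with hδ
    have hδhi : δ * 4 ^ 2 ^ n ≤ hi := by rwa [hδ, mul_assoc, ← pow_add, ← mul_two, ← pow_succ]
    have hloδ : lo < δ := lt_mul_of_one_lt_right hlo (one_lt_pow₀ (by norm_num) (by positivity))
    have hδ_le : δ ≤ hi :=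
      (le_mul_of_one_le_right (by linarith) (one_le_pow₀ (by norm_num))).trans hδhi
    let x : Item := ⟨u + δ, by linarith, by linarith⟩
    by_cases hx : P past x ∈ (packing P [] past).support
    · obtain ⟨I, α, hn, hα, hI⟩ := ih (past ++ [x]) (by linarith) hδhi hhi
      refine ⟨x :: I, α, by simp [hn], by linarith, hI.cons_small ⟨?_, ?_⟩ hx⟩ <;>
        simp only [x] <;> linarith
    · obtain ⟨I, α, hn, hα, hI⟩ := ih (past ++ [x]) hlo hδ.ge (by linarith)
      refine ⟨x :: I, α, by simp [hn], hα, (hI.mono hδ_le).cons_large ⟨?_, ?_⟩ hx⟩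
      · simpa only [x] using add_le_add_right hI.four_mul_le u
      · simpa only [x] using add_le_add_right hδ_le u

theorem exists_isAdaptiveStage (P : Rule) (past : Input) (n : ℕ) {u ε : ℚ} (hu : 0 ≤ u)
    (hε : 0 < ε) (huε : u + ε ≤ 1) : ∃ I α, I.length = n ∧ IsAdaptiveStage P past I u α ε := by
  obtain ⟨I, α, hn, -, hI⟩ := exists_isAdaptiveStage_of_mul_le P (lo := ε / 4 ^ 2 ^ n) n past hu
    (by positivity) (div_mul_cancel₀ ε (by positivity)).le huε
  exact ⟨I, α, hn, hI⟩

namespace IsAdaptiveStage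

variable {P : Rule} {past I : Input} {u α ε : ℚ} {b : ℕ}

theorem le_of_mem_sizes (h : IsAdaptiveStage P past I u α ε) : ∀ x ∈ sizes I, u ≤ x :=
  fun x hx ↦ (h.mem_Ioc x hx).1.le

theorem exists_split (h : IsAdaptiveStage P past I u α ε) :
    ∃ L S, sizes I = L + S ∧ L.card + S.card = I.length ∧
      (packing P [] (past ++ I)).support.card = (packing P [] past).support.card + L.card ∧
      (∀ x ∈ L, x ≤ u + ε) ∧ ∀ x ∈ S, x ≤ u + α := by
  have hsplit := Multiset.filter_add_not (u + α < ·) (sizes I)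
  refine ⟨_, _, hsplit.symm, ?_, h.card_support, fun x hx ↦ ?_, fun x hx ↦ ?_⟩
  · rw [← Multiset.card_add, hsplit, card_sizes]
  · exact (h.mem_Ioc x (Multiset.mem_filter.1 hx).1).2
  · exact not_lt.1 (Multiset.mem_filter.1 hx).2

theorem exists_split_nil (h : IsAdaptiveStage P [] I u α ε) :
    ∃ L S, sizes I = L + S ∧ L.card + S.card = I.length ∧
      L.card = (packing P [] I).support.card ∧
      (∀ x ∈ L, x ≤ u + ε) ∧ ∀ x ∈ S, x ≤ u + α := by
  obtain ⟨L, S, hLS, hcard, hL, h⟩ := h.exists_split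
  exact ⟨L, S, hLS, hcard, by simpa [packing] using hL.symm, h⟩

theorem packableIn {n : ℕ} (h : IsAdaptiveStage P past I u α ε) (hu : 0 ≤ u) (k : ℕ)
    (hI : I.length ≤ k * n) : PackableIn (sizes I) n (k * (u + ε)) :=
  .of_card_le_mul (by linarith [h.pos, h.four_mul_le]) k (fun x hx ↦ (h.mem_Ioc x hx).2)
    (by rwa [card_sizes])

theorem card_mul_add_le_sum (h : IsAdaptiveStage P past I u α ε)
    (hb : b ∈ (packing P [] (past ++ I)).support) (hb' : b ∉ (packing P [] past).support) :
    (packing P past I b).card * u + 4 * α ≤ (packing P past I b).sum := by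
  obtain ⟨x, hx, hux⟩ := h.exists_large b hb hb'
  linarith [card_packing_sub_one_mul_add_le_sum h.le_of_mem_sizes hx]

theorem card_mul_add_le_sum_nil (h : IsAdaptiveStage P [] I u α ε)
    (hb : b ∈ (packing P [] I).support) :
    (packing P [] I b).card * u + 4 * α ≤ (packing P [] I b).sum :=
  h.card_mul_add_le_sum hb (by simp [packing])

theorem card_mul_add_card_mul_lt_sum {J : Input} {u' α' ε' : ℚ}
    (h : IsAdaptiveStage P [] I u α ε) (h' : IsAdaptiveStage P I J u' α' ε')
    (hb : b ∈ (packing P [] (I ++ J)).support) :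
    (packing P [] I b).card * u + (packing P I J b).card * u' < (packing P [] (I ++ J) b).sum := by
  have hα := h.pos
  have hα' := h'.pos
  rw [packing_nil_append, Finsupp.add_apply, Multiset.sum_add]
  by_cases hbI : b ∈ (packing P [] I).support
  · linarith [h.card_mul_add_le_sum_nil hbI,
      card_packing_mul_le_sum (P := P) (past := I) (b := b) h'.le_of_mem_sizes]
  · linarith [h'.card_mul_add_le_sum hb hbI,
      card_packing_mul_le_sum (P := P) (past := []) (b := b) h.le_of_mem_sizes]

end IsAdaptiveStage

/-- The number of bins of the packing `p` that contain at least `k` items. -/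
def level (p : ℕ →₀ Multiset ℚ) (k : ℕ) : ℕ := (p.support.filter fun b ↦ k ≤ (p b).card).card

section Level

variable {p : ℕ →₀ Multiset ℚ} {U : Finset ℕ} {k : ℕ}

theorem level_antitone (p : ℕ →₀ Multiset ℚ) : Antitone (level p) := fun _ _ hkl ↦
  Finset.card_le_card (Finset.monotone_filter_right _ fun _ _ ↦ hkl.trans)

theorem level_eq_sum (hk : k ≠ 0) (hU : p.support ⊆ U) :
    level p k = ∑ b ∈ U, if k ≤ (p b).card then 1 else 0 := by
  rw [level, Finset.card_filter]
  refine Finset.sum_subset hU fun b _ hb ↦ ?_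
  rw [Finsupp.notMem_support_iff.1 hb]
  simpa using hk

theorem level_one (p : ℕ →₀ Multiset ℚ) : level p 1 = p.support.card := by
  rw [level, Finset.filter_true_of_mem]
  exact fun b hb ↦ Multiset.card_pos.2 (Finsupp.mem_support_iff.1 hb)

theorem sum_card_eq_sum_level {n : ℕ} (hn : ∀ b, (p b).card ≤ n) :
    ∑ b ∈ p.support, (p b).card = ∑ k ∈ Finset.range n, level p (k + 1) := by
  simp only [level, Finset.card_filter]
  rw [Finset.sum_comm]
  refine Finset.sum_congr rfl fun b _ ↦ ?_
  have hlevels : (Finset.range n).filter (· + 1 ≤ (p b).card) = Finset.range (p b).card := by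
    ext k
    have := hn b
    simp only [Finset.mem_filter, Finset.mem_range]
    omega
  rw [← Finset.card_filter, hlevels, Finset.card_range]

end Level

section TinyItems

variable {P : Rule} {Q c : ℕ} {I : Input} {α : ℚ}

theorem card_packing_tiny_le (hP : PacksWithin P Q c)
    (h : IsAdaptiveStage P [] I (1 / 8) α (1 / 1000)) (hQ : I.length ≤ Q) (b : ℕ) :
    (packing P [] I b).card ≤ 7 := by
  by_cases hb : b ∈ (packing P [] I).support
  · have hload := h.card_mul_add_le_sum_nil hb
    have hone := hP.sum_packing_le_one ((h.packableIn (by norm_num) 1 (by simpa)).mono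
      (by norm_num)) b
    have hα := h.pos
    have : ((packing P [] I b).card : ℚ) < 8 := by linarith
    exact Nat.lt_succ_iff.1 (by exact_mod_cast this)
  · simp [Finsupp.notMem_support_iff.1 hb]

theorem card_support_tiny_add_le (hP : PacksWithin P Q c)
    (h : IsAdaptiveStage P [] I (1 / 8) α (1 / 1000)) (hQ : I.length = Q) :
    6 * (packing P [] I).support.card + 7 * Q ≤ 7 * c + 6 := by
  obtain ⟨L, S, hI, hn, hX, hL, hS⟩ := h.exists_split_nil
  have hα := h.pos
  have hαε := h.four_mul_le
  set X := (packing P [] I).support.card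
  set m := (X + 6) / 7
  let w : Item := ⟨7 / 8 - α, by linarith, by linarith⟩
  have hw : (w : ℚ) = 7 / 8 - α := rfl
  have hpackL : PackableIn L m 1 :=
    (PackableIn.of_card_le_mul (u := 63 / 500) (by norm_num) 7
      (fun x hx ↦ (hL x hx).trans (by norm_num)) (by omega)).mono (by norm_num)
  have hpackS : PackableIn (S + Multiset.replicate (Q - m) (w : ℚ)) (Q - m) 1 :=
    ((PackableIn.of_card_le (by linarith) hS (by omega)).superpose
      (.replicate (by linarith) _)).mono (by linarith)
  have hpack := hpackL.juxtapose hpackS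
  rw [← add_assoc, ← hI, Nat.add_sub_cancel' (by omega)] at hpack
  have hX' := hP.card_support_add_le (by linarith) hpack fun b hb ↦ by
    have hcard : (1 : ℚ) ≤ (packing P [] I b).card := by
      exact_mod_cast Multiset.card_pos.2 (Finsupp.mem_support_iff.1 hb)
    linarith [h.card_mul_add_le_sum_nil hb]
  omega

end TinyItems

section MediumItems

variable {P : Rule} {Q c : ℕ} {I J : Input} {α β : ℚ}

theorem card_support_medium_add_le (hP : PacksWithin P Q c)
    (h : IsAdaptiveStage P [] I (1 / 8) α (1 / 1000)) (hI : I.length = Q)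
    (h' : IsAdaptiveStage P I J (9 / 25) β (1 / 1000)) (hJ : J.length = Q) {t : ℕ}
    (ht : 2 * t ≤ Q) : (packing P [] (I ++ J)).support.card + t ≤ c := by
  let w : Item := ⟨1, by norm_num⟩
  have hpackIJ : PackableIn (sizes (I ++ J)) (Q - t) 1 := by
    rw [sizes_append]
    exact ((h.packableIn (by norm_num) 2 (by omega)).superpose
      (h'.packableIn (by norm_num) 2 (by omega))).mono (by norm_num)
  have hpack := hpackIJ.juxtapose (.replicate (u := w) zero_le_one t)
  rw [Nat.sub_add_cancel (by omega)] at hpack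
  refine hP.card_support_add_le (by norm_num [w]) hpack fun b hb ↦ ?_
  obtain ⟨x, hx⟩ := Multiset.exists_mem_of_ne_zero (Finsupp.mem_support_iff.1 hb)
  have hsum := Multiset.single_le_sum (fun y hy ↦
    (mem_Ioc_of_mem_sizes (mem_sizes_of_mem_packing hy)).1.le) x hx
  have hx0 := (mem_Ioc_of_mem_sizes (mem_sizes_of_mem_packing hx)).1
  simp only [w]
  linarith

theorem card_closedBins_half_add_le (hP : PacksWithin P Q c)
    (h : IsAdaptiveStage P [] I (1 / 8) α (1 / 1000)) (hI : I.length = Q)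
    (h' : IsAdaptiveStage P I J (9 / 25) β (1 / 1000)) (hJ : J.length = Q) :
    (closedBins (packing P [] (I ++ J)) (101 / 200)).card + Q ≤ c := by
  let w : Item := ⟨101 / 200, by norm_num⟩
  refine hP.card_closedBins_add_le (w := w) (by norm_num [w]) ?_
  rw [sizes_append]
  exact (((h.packableIn (by norm_num) 1 (by omega)).superpose
    (h'.packableIn (by norm_num) 1 (by omega))).superpose
    (.replicate (by norm_num [w]) Q)).mono (by norm_num [w])

theorem packableIn_medium_complement {T L S : Multiset ℚ} {e : ℕ} (hβ : 0 < β)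
    (hβε : 4 * β ≤ 1 / 1000) (hT : ∀ x ∈ T, x ≤ 63 / 500) (hL : ∀ x ∈ L, x ≤ 361 / 1000)
    (hS : ∀ x ∈ S, x ≤ 9 / 25 + β) (hTQ : T.card = Q) (hLSQ : L.card + S.card = Q)
    (hLe : L.card ≤ 2 * e) (hQe : Q ≤ 4 * e) (heQ : 2 * e ≤ Q) :
    PackableIn (T + (L + S) + Multiset.replicate (Q - e) (16 / 25 - β)) Q 1 := by
  obtain ⟨S₁, S₂, rfl, hS₁⟩ := exists_eq_add_card_eq (s := S) (k := 2 * e - L.card) (by omega)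
  obtain ⟨T₁, T₂, rfl, hT₁⟩ := exists_eq_add_card_eq (s := T) (k := 2 * e) (by omega)
  rw [Multiset.card_add] at hTQ hLSQ
  simp only [Multiset.mem_add] at hT hS
  have hmedium : ∀ x ∈ L + S₁, x ≤ 361 / 1000 := fun x hx ↦
    (Multiset.mem_add.1 hx).elim (hL x) fun hx ↦ (hS x (.inl hx)).trans (by linarith)
  have hpack₁ : PackableIn (T₁ + (L + S₁)) e 1 :=
    ((PackableIn.of_card_le_mul (by norm_num) 2 (fun x hx ↦ hT x (.inl hx)) hT₁.le).superpose
      (.of_card_le_mul (by norm_num) 2 hmedium (by rw [Multiset.card_add]; omega))).mono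
      (by norm_num)
  have hpack₂ :
      PackableIn (S₂ + Multiset.replicate (Q - 2 * e) (16 / 25 - β)) (Q - 2 * e) 1 :=
    ((PackableIn.of_card_le (by linarith) (fun x hx ↦ hS x (.inr hx)) (by omega)).superpose
      (.replicate (by linarith) _)).mono (by linarith)
  have hpack₃ : PackableIn (T₂ + Multiset.replicate e (16 / 25 - β)) e 1 :=
    ((PackableIn.of_card_le_mul (by norm_num) 2 (fun x hx ↦ hT x (.inr hx))
      (by omega)).superpose (.replicate (by linarith) _)).mono (by push_cast; linarith)
  have hpack := (hpack₁.juxtapose hpack₂).juxtapose hpack₃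
  rw [show e + (Q - 2 * e) + e = Q by omega] at hpack
  convert hpack using 1
  rw [show Q - e = (Q - 2 * e) + e by omega, Multiset.replicate_add]
  abel

theorem card_closedBins_complement_add_le (hP : PacksWithin P Q c)
    (h : IsAdaptiveStage P [] I (1 / 8) α (1 / 1000)) (hI : I.length = Q)
    (h' : IsAdaptiveStage P I J (9 / 25) β (1 / 1000)) (hJ : J.length = Q) {e : ℕ}
    (he : (packing P [] (I ++ J)).support.card ≤ (packing P [] I).support.card + 2 * e)
    (hQe : Q ≤ 4 * e) (heQ : 2 * e ≤ Q) :
    (closedBins (packing P [] (I ++ J)) (16 / 25 - β)).card + (Q - e) ≤ c := by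
  obtain ⟨L, S, hLS, hn, hX, hL, hS⟩ := h'.exists_split
  have hβ := h'.pos
  have hβε := h'.four_mul_le
  let w : Item := ⟨16 / 25 - β, by linarith, by linarith⟩
  have hw : 1 / 2 < (w : ℚ) := by simp only [w]; linarith
  refine hP.card_closedBins_add_le (w := w) hw ?_
  rw [sizes_append, hLS]
  exact packableIn_medium_complement hβ hβε (fun x hx ↦ (h.mem_Ioc x hx).2.trans (by norm_num))
    (fun x hx ↦ (hL x hx).trans (by norm_num)) hS ((card_sizes I).trans hI) (hn.trans hJ)
    (by omega) hQe heQ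

theorem medium_bin (hsum : ∀ b, (packing P [] (I ++ J) b).sum ≤ 1)
    (h : IsAdaptiveStage P [] I (1 / 8) α (1 / 1000))
    (h' : IsAdaptiveStage P I J (9 / 25) β (1 / 1000)) {b a n : ℕ}
    (hb : b ∈ (packing P [] (I ++ J)).support) (ha : (packing P [] I b).card = a)
    (hn : (packing P I J b).card = n) :
    125 * a + 360 * n < 1000 ∧
      (1 < (packing P [] (I ++ J) b).sum + 101 / 200 ∨ 125 * a + 360 * n ≤ 495) ∧
      (1 < (packing P [] (I ++ J) b).sum + (16 / 25 - β) ∨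
        125 * a + 360 * n ≤ 361 ∧ a ≠ 0) := by
  have hβ := h'.pos
  have hone := hsum b
  have hload := h.card_mul_add_card_mul_lt_sum h' hb
  rw [ha, hn] at hload
  refine ⟨?_, or_iff_not_imp_left.2 fun hopen ↦ ?_, or_iff_not_imp_left.2 fun hopen ↦ ⟨?_, ?_⟩⟩
  · have : (125 * a + 360 * n : ℚ) < 1000 := by linarith
    exact_mod_cast this
  · have : (125 * a + 360 * n : ℚ) ≤ 495 := by linarith
    exact_mod_cast this
  · have hβε := h'.four_mul_le
    have : (125 * a + 360 * n : ℚ) ≤ 361 := by linarith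
    exact_mod_cast this
  · rintro rfl
    have hbI : packing P [] I b = 0 := Multiset.card_eq_zero.1 ha
    have hloadJ := h'.card_mul_add_le_sum hb (by simpa using hbI)
    rw [packing_nil_append, Finsupp.add_apply, hbI, zero_add] at hopen
    rw [support_packing_nil_append, Finset.mem_union] at hb
    have : (1 : ℚ) ≤ (packing P I J b).card := by
      exact_mod_cast Multiset.card_pos.2 (by simpa [hbI] using hb)
    linarith

theorem level_three_add_level_six_add_le (hsum : ∀ b, (packing P [] (I ++ J) b).sum ≤ 1)
    (h : IsAdaptiveStage P [] I (1 / 8) α (1 / 1000))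
    (h' : IsAdaptiveStage P I J (9 / 25) β (1 / 1000)) :
    level (packing P [] I) 3 + level (packing P [] I) 6 + J.length ≤
      (closedBins (packing P [] (I ++ J)) (101 / 200)).card +
        (closedBins (packing P [] (I ++ J)) (16 / 25 - β)).card := by
  have hunion := support_packing_nil_append (P := P) (I := I) (J := J)
  have hsub : (packing P [] I).support ⊆ (packing P [] (I ++ J)).support :=
    hunion ▸ Finset.subset_union_left
  rw [level_eq_sum (by norm_num) hsub, level_eq_sum (by norm_num) hsub,
    ← sum_card_packing (hunion ▸ Finset.subset_union_right), closedBins, closedBins,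
    Finset.card_filter, Finset.card_filter, ← Finset.sum_add_distrib, ← Finset.sum_add_distrib,
    ← Finset.sum_add_distrib]
  refine Finset.sum_le_sum fun b hb ↦ ?_
  obtain ⟨hload, hhalf | hhalf, hcompl | hcompl⟩ := medium_bin hsum h h' hb rfl rfl <;>
    split_ifs <;> omega

theorem two_mul_level_three_add_le (hsum : ∀ b, (packing P [] (I ++ J) b).sum ≤ 1)
    (h : IsAdaptiveStage P [] I (1 / 8) α (1 / 1000))
    (h' : IsAdaptiveStage P I J (9 / 25) β (1 / 1000)) :
    2 * level (packing P [] I) 3 + level (packing P [] I) 6 + J.length +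
        (packing P [] (I ++ J)).support.card ≤
      level (packing P [] I) 1 + (closedBins (packing P [] (I ++ J)) (101 / 200)).card +
        2 * (closedBins (packing P [] (I ++ J)) (16 / 25 - β)).card := by
  have hunion := support_packing_nil_append (P := P) (I := I) (J := J)
  have hsub : (packing P [] I).support ⊆ (packing P [] (I ++ J)).support :=
    hunion ▸ Finset.subset_union_left
  rw [level_eq_sum (by norm_num) hsub, level_eq_sum (by norm_num) hsub,
    level_eq_sum (by norm_num) hsub,
    ← sum_card_packing (hunion ▸ Finset.subset_union_right), closedBins, closedBins,
    Finset.card_filter, Finset.card_filter, Finset.card_eq_sum_ones]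
  simp only [Finset.mul_sum, ← Finset.sum_add_distrib]
  refine Finset.sum_le_sum fun b hb ↦ ?_
  obtain ⟨hload, hhalf | hhalf, hcompl | hcompl⟩ := medium_bin hsum h h' hb rfl rfl <;>
    split_ifs <;> omega

theorem level_three_add_level_six_add_le_or {M : ℕ} (hP : PacksWithin P (4 * M) c)
    (h : IsAdaptiveStage P [] I (1 / 8) α (1 / 1000)) (hI : I.length = 4 * M) :
    level (packing P [] I) 3 + level (packing P [] I) 6 + 11 * M ≤ 2 * c ∨
      level (packing P [] I) 1 + level (packing P [] I) 3 + level (packing P [] I) 6 + 15 * M ≤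
          3 * c + 1 ∧
        2 * level (packing P [] I) 3 + level (packing P [] I) 6 + 16 * M ≤ 3 * c + 2 := by
  obtain ⟨J, β, hJ, h'⟩ := exists_isAdaptiveStage P I (4 * M) (u := 9 / 25) (ε := 1 / 1000)
    (by norm_num) (by norm_num) (by norm_num)
  have hpack : PackableIn (sizes (I ++ J)) (4 * M) 1 := by
    rw [sizes_append]
    exact ((h.packableIn (by norm_num) 1 (by omega)).superpose
      (h'.packableIn (by norm_num) 1 (by omega))).mono (by norm_num)
  have hsum := hP.sum_packing_le_one hpack
  have hlevel := level_three_add_level_six_add_le hsum h h'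
  have hlevel' := two_mul_level_three_add_le hsum h h'
  have hone := level_one (packing P [] I)
  have hfull := card_support_medium_add_le hP h hI h' hJ (t := 2 * M) (by omega)
  have hhalf := card_closedBins_half_add_le hP h hI h' hJ
  obtain ⟨L, S, -, hn, hX, -, -⟩ := h'.exists_split
  have hcomplement (e : ℕ) (he : L.card ≤ 2 * e) :=
    card_closedBins_complement_add_le hP h hI h' hJ (e := e) (by omega)
  -- If few medium items open a bin, the ones that do fit into `M` bins, two in each.
  obtain hL | hL := le_total L.card (2 * M)
  · have := hcomplement M hL (by omega) (by omega)
    omega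
  · have := hcomplement ((L.card + 1) / 2) (by omega) (by omega) (by omega)
    omega

end MediumItems

section TightPackings

variable {L S : Multiset ℚ} {K t : ℕ} {α : ℚ}

theorem packableIn_tight (hα : 0 < α) (hαε : 4 * α ≤ 1 / 1000) (hL : ∀ x ∈ L, x ≤ 63 / 500)
    (hS : ∀ x ∈ S, x ≤ 1 / 8 + α) (hLS : L.card + S.card = 40 * K) (hLK : L.card ≤ 19 * K) :
    PackableIn (L + S + Multiset.replicate (38 * K) (3 / 8 - 3 / 2 * α) +
      Multiset.replicate (21 * K) (7 / 8 - α)) (40 * K) 1 := by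
  obtain ⟨S₁, S₂, rfl, hS₁⟩ :=
    exists_eq_add_card_eq (s := S) (k := 2 * (19 * K - L.card)) (by omega)
  rw [Multiset.card_add] at hLS
  simp only [Multiset.mem_add] at hS
  set v := 3 / 8 - 3 / 2 * α with hv
  have hv0 : 0 ≤ v := by linarith
  have hpack₁ : PackableIn (L + Multiset.replicate (2 * L.card) v) L.card 1 :=
    ((PackableIn.of_card_le (by norm_num) hL le_rfl).superpose (.replicate_mul hv0 2 _)).mono
      (by push_cast; linarith)
  have hpack₂ : PackableIn (S₁ + Multiset.replicate (2 * (19 * K - L.card)) v)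
      (19 * K - L.card) 1 :=
    ((PackableIn.of_card_le_mul (by linarith) 2 (fun x hx ↦ hS x (.inl hx)) hS₁.le).superpose
      (.replicate_mul hv0 2 _)).mono (by push_cast; linarith)
  have hpack₃ : PackableIn (S₂ + Multiset.replicate (21 * K) (7 / 8 - α)) (21 * K) 1 :=
    ((PackableIn.of_card_le (by linarith) (fun x hx ↦ hS x (.inr hx)) (by omega)).superpose
      (.replicate (by linarith) _)).mono (by linarith)
  have hpack := (hpack₁.juxtapose hpack₂).juxtapose hpack₃
  rw [show L.card + (19 * K - L.card) + 21 * K = 40 * K by omega] at hpack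
  convert hpack using 1
  rw [show 38 * K = 2 * L.card + 2 * (19 * K - L.card) by omega, Multiset.replicate_add]
  abel

theorem packableIn_tight_half (hα : 0 < α) (hαε : 4 * α ≤ 1 / 1000)
    (hL : ∀ x ∈ L, x ≤ 63 / 500) (hS : ∀ x ∈ S, x ≤ 1 / 8 + α) (hLS : L.card + S.card = 40 * K)
    (hKt : 2 * K ≤ t) (hLt : L.card + 2 * K ≤ 4 * t) (htL : 2 * t ≤ L.card + 2 * K)
    (htK : t ≤ 21 * K) :
    PackableIn (L + S + Multiset.replicate (38 * K) (3 / 8 - 3 / 2 * α) +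
      Multiset.replicate (42 * K - t) (1 / 2 + α / 2)) (40 * K) 1 := by
  obtain ⟨L₁, L₂, rfl, hL₁⟩ := exists_eq_add_card_eq (min_le_right (3 * t) L.card)
  rw [Multiset.card_add] at hLS hLt htL hL₁
  simp only [Multiset.mem_add] at hL
  set v := 3 / 8 - 3 / 2 * α with hv
  set w := 1 / 2 + α / 2 with hw
  have hv0 : 0 ≤ v := by linarith
  have hw0 : 0 ≤ w := by linarith
  have hpack₁ : PackableIn (L₁ + Multiset.replicate t w) t 1 :=
    ((PackableIn.of_card_le_mul (by norm_num) 3 (fun x hx ↦ hL x (.inl hx))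
      (by omega)).superpose (.replicate hw0 _)).mono (by push_cast; linarith)
  have hpack₂ : PackableIn (L₂ + Multiset.replicate (2 * (t - 2 * K)) v) (t - 2 * K) 1 :=
    ((PackableIn.of_card_le (by norm_num) (fun x hx ↦ hL x (.inr hx)) (by omega)).superpose
      (.replicate_mul hv0 2 _)).mono (by push_cast; linarith)
  have hpack₃ : PackableIn (S + Multiset.replicate (42 * K - 2 * t) v +
      Multiset.replicate (42 * K - 2 * t) w) (42 * K - 2 * t) 1 :=
    (((PackableIn.of_card_le (by linarith) hS (by omega)).superpose
      (.replicate hv0 _)).superpose (.replicate hw0 _)).mono (by linarith)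
  have hpack := (hpack₁.juxtapose hpack₂).juxtapose hpack₃
  rw [show t + (t - 2 * K) + (42 * K - 2 * t) = 40 * K by omega] at hpack
  convert hpack using 1
  rw [show 38 * K = 2 * (t - 2 * K) + (42 * K - 2 * t) by omega,
    show 42 * K - t = t + (42 * K - 2 * t) by omega, Multiset.replicate_add,
    Multiset.replicate_add]
  abel

end TightPackings

section TightItems

variable {P : Rule} {c K : ℕ} {I J : Input} {α : ℚ}

theorem tight_bin (hsum : ∀ b, (packing P [] (I ++ J) b).sum ≤ 1)
    (h : IsAdaptiveStage P [] I (1 / 8) α (1 / 1000))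
    (hJ : ∀ x ∈ sizes J, 3 / 8 - 3 / 2 * α ≤ x) {b a n : ℕ}
    (ha : (packing P [] I b).card = a) (hn : (packing P I J b).card = n) :
    a + 3 * n < 8 ∧
      (1 < (packing P [] (I ++ J) b).sum + (1 / 2 + α / 2) ∨ a + 3 * n < 4) := by
  have hα := h.pos
  have hαε := h.four_mul_le
  have hone := hsum b
  have hloadI := card_packing_mul_le_sum (P := P) (past := []) (b := b) h.le_of_mem_sizes
  have hloadJ := card_packing_mul_le_sum (P := P) (past := I) (b := b) hJ
  have hold : a ≠ 0 → (a : ℚ) * (1 / 8) + 4 * α ≤ (packing P [] I b).sum := fun ha0 ↦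
    ha ▸ h.card_mul_add_le_sum_nil (Finsupp.mem_support_iff.2 (by simpa [← ha] using ha0))
  rw [ha] at hloadI
  rw [hn] at hloadJ
  rw [packing_nil_append, Finsupp.add_apply, Multiset.sum_add] at hone ⊢
  set x := (packing P [] I b).sum
  set y := (packing P I J b).sum
  have ha' : (0 : ℚ) ≤ a := a.cast_nonneg
  have hn2 : n ≤ 2 := by
    by_contra! hn3
    have : (3 : ℚ) ≤ n := by exact_mod_cast hn3
    nlinarith
  have hn2' : (n : ℚ) ≤ 2 := by exact_mod_cast hn2
  obtain rfl | ha0 := eq_or_ne a 0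
  · refine ⟨by omega, or_iff_not_imp_left.2 fun hopen ↦ ?_⟩
    have : (n : ℚ) < 2 := by nlinarith
    have : n < 2 := by exact_mod_cast this
    omega
  · have hload : ((a + 3 * n : ℚ)) / 8 + α ≤ x + y := by nlinarith [hold ha0]
    refine ⟨?_, or_iff_not_imp_left.2 fun hopen ↦ ?_⟩
    · have : (a + 3 * n : ℚ) < 8 := by linarith
      exact_mod_cast this
    · have : (a + 3 * n : ℚ) < 4 := by linarith
      exact_mod_cast this

theorem level_two_add_level_five_add_le (hsum : ∀ b, (packing P [] (I ++ J) b).sum ≤ 1)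
    (h : IsAdaptiveStage P [] I (1 / 8) α (1 / 1000))
    (hJ : ∀ x ∈ sizes J, 3 / 8 - 3 / 2 * α ≤ x) :
    level (packing P [] I) 2 + level (packing P [] I) 5 + J.length ≤
      (packing P [] (I ++ J)).support.card +
        (closedBins (packing P [] (I ++ J)) (1 / 2 + α / 2)).card := by
  have hunion := support_packing_nil_append (P := P) (I := I) (J := J)
  have hsub : (packing P [] I).support ⊆ (packing P [] (I ++ J)).support :=
    hunion ▸ Finset.subset_union_left
  rw [level_eq_sum (by norm_num) hsub, level_eq_sum (by norm_num) hsub,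
    ← sum_card_packing (hunion ▸ Finset.subset_union_right), closedBins, Finset.card_filter,
    Finset.card_eq_sum_ones, ← Finset.sum_add_distrib, ← Finset.sum_add_distrib,
    ← Finset.sum_add_distrib]
  refine Finset.sum_le_sum fun b _ ↦ ?_
  obtain ⟨hload, hhalf | hhalf⟩ := tight_bin hsum h hJ rfl rfl (b := b) <;> split_ifs <;> omega

theorem one_lt_sum_packing_tight_add (h : IsAdaptiveStage P [] I (1 / 8) α (1 / 1000))
    (hJ : ∀ x ∈ sizes J, 3 / 8 - 3 / 2 * α ≤ x) {b : ℕ}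
    (hb : b ∈ (packing P [] (I ++ J)).support) :
    1 < (packing P [] (I ++ J) b).sum + (7 / 8 - α) := by
  have hα := h.pos
  have hαε := h.four_mul_le
  rw [packing_nil_append, Finsupp.add_apply, Multiset.sum_add]
  have hx : 0 ≤ (packing P [] I b).sum := sum_packing_apply_nonneg
  have hy : 0 ≤ (packing P I J b).sum := sum_packing_apply_nonneg
  rw [support_packing_nil_append, Finset.mem_union] at hb
  have one_le_card {past I : Input} (hb : b ∈ (packing P past I).support) :
      (1 : ℚ) ≤ (packing P past I b).card := by
    exact_mod_cast Multiset.card_pos.2 (Finsupp.mem_support_iff.1 hb)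
  obtain hb | hb := hb
  · linarith [h.card_mul_add_le_sum_nil hb, one_le_card hb]
  · nlinarith [card_packing_mul_le_sum (P := P) (past := I) (b := b) hJ, one_le_card hb]

theorem card_support_tight_add_le (hP : PacksWithin P (40 * K) c)
    (h : IsAdaptiveStage P [] I (1 / 8) α (1 / 1000)) (hI : I.length = 40 * K)
    (hJ : sizes J = Multiset.replicate (38 * K) (3 / 8 - 3 / 2 * α))
    (hX : (packing P [] I).support.card ≤ 19 * K) :
    (packing P [] (I ++ J)).support.card + 21 * K ≤ c := by
  have hα := h.pos
  have hαε := h.four_mul_le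
  obtain ⟨L, S, hLS, hn, hLX, hL, hS⟩ := h.exists_split_nil
  let w : Item := ⟨7 / 8 - α, by linarith, by linarith⟩
  refine hP.card_support_add_le (w := w) (by simp only [w]; linarith) ?_ fun b hb ↦
    one_lt_sum_packing_tight_add h
      (fun x hx ↦ (Multiset.eq_of_mem_replicate (hJ ▸ hx)).ge) hb
  rw [sizes_append, hLS, hJ]
  exact packableIn_tight hα hαε (fun x hx ↦ (hL x hx).trans (by norm_num)) hS (hn.trans hI)
    (hLX.trans_le hX)

theorem card_closedBins_tight_add_le (hP : PacksWithin P (40 * K) c)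
    (h : IsAdaptiveStage P [] I (1 / 8) α (1 / 1000)) (hI : I.length = 40 * K)
    (hJ : sizes J = Multiset.replicate (38 * K) (3 / 8 - 3 / 2 * α)) {t : ℕ} (hKt : 2 * K ≤ t)
    (hXt : (packing P [] I).support.card + 2 * K ≤ 4 * t)
    (htX : 2 * t ≤ (packing P [] I).support.card + 2 * K) (htK : t ≤ 21 * K) :
    (closedBins (packing P [] (I ++ J)) (1 / 2 + α / 2)).card + (42 * K - t) ≤ c := by
  have hα := h.pos
  have hαε := h.four_mul_le
  obtain ⟨L, S, hLS, hn, hLX, hL, hS⟩ := h.exists_split_nil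
  let w : Item := ⟨1 / 2 + α / 2, by linarith, by linarith⟩
  refine hP.card_closedBins_add_le (w := w) (by simp only [w]; linarith) ?_
  rw [sizes_append, hLS, hJ]
  exact packableIn_tight_half hα hαε (fun x hx ↦ (hL x hx).trans (by norm_num)) hS
    (hn.trans hI) hKt (by rwa [hLX]) (by rwa [hLX]) htK

theorem four_mul_level_two_add_level_five_le (hP : PacksWithin P (40 * K) c)
    (h : IsAdaptiveStage P [] I (1 / 8) α (1 / 1000)) (hI : I.length = 40 * K)
    (hX : 2 * K ≤ (packing P [] I).support.card) (hX' : (packing P [] I).support.card ≤ 19 * K) :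
    4 * (level (packing P [] I) 2 + level (packing P [] I) 5 + 101 * K) ≤
      8 * c + max (8 * K) ((packing P [] I).support.card + 2 * K + 3) := by
  have hα := h.pos
  have hαε := h.four_mul_le
  let v : Item := ⟨3 / 8 - 3 / 2 * α, by linarith, by linarith⟩
  set J : Input := List.replicate (38 * K) v
  have hJ : sizes J = Multiset.replicate (38 * K) (3 / 8 - 3 / 2 * α) := sizes_replicate _ v
  have hpack : PackableIn (sizes (I ++ J)) (40 * K) 1 := by
    rw [sizes_append, hJ]
    exact ((h.packableIn (by norm_num) 1 (by omega)).superpose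
      ((PackableIn.replicate (by linarith) _).mono_bins (by linarith) (by omega))).mono
      (by push_cast; linarith)
  have hlevel := level_two_add_level_five_add_le (hP.sum_packing_le_one hpack) h fun x hx ↦
    (Multiset.eq_of_mem_replicate (hJ ▸ hx)).ge
  have hfull := card_support_tight_add_le hP h hI hJ hX'
  set t := max (2 * K) (((packing P [] I).support.card + 2 * K + 3) / 4)
  have hhalf := card_closedBins_tight_add_le hP h hI hJ (t := t) (by omega) (by omega) (by omega)
    (by omega)
  have hJlen : J.length = 38 * K := List.length_replicate
  omega

end TightItems

theorem sum_range_seven_le_of_antitone {N : ℕ → ℕ} (hN : Antitone N) :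
    ∑ k ∈ Finset.range 7, N (k + 1) ≤ N 1 + (N 2 + N 5) + 2 * (N 3 + N 6) := by
  have h34 := hN (show 3 ≤ 4 by norm_num)
  have h67 := hN (show 6 ≤ 7 by norm_num)
  simp only [Finset.sum_range_succ, Finset.sum_range_zero, Nat.reduceAdd, zero_add]
  linarith

theorem four_mul_sum_range_seven_add_le_of_antitone {N : ℕ → ℕ} (hN : Antitone N) :
    4 * ∑ k ∈ Finset.range 7, N (k + 1) + N 1 ≤
      4 * (N 2 + N 5) + 5 * (N 1 + N 3 + N 6) + 2 * (2 * N 3 + N 6) := by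
  have h34 := hN (show 3 ≤ 4 by norm_num)
  have h37 := hN (show 3 ≤ 7 by norm_num)
  have h67 := hN (show 6 ≤ 7 by norm_num)
  simp only [Finset.sum_range_succ, Finset.sum_range_zero, Nat.reduceAdd, zero_add]
  linarith

theorem PacksWithin.mul_le_mul_add {P : Rule} {K c : ℕ} (hP : PacksWithin P (40 * K) c) :
    2513 * (40 * K) ≤ 1790 * c + 10 ^ 6 := by
  obtain ⟨I, α, hI, h⟩ := exists_isAdaptiveStage P [] (40 * K) (u := 1 / 8) (ε := 1 / 1000)
    (by norm_num) (by norm_num) (by norm_num)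
  have hcard := card_packing_tiny_le hP h hI.le
  have hcount : ∑ k ∈ Finset.range 7, level (packing P [] I) (k + 1) = 40 * K := by
    rw [← sum_card_eq_sum_level hcard, sum_card_packing subset_rfl, hI]
  have hbins : 40 * K ≤ 7 * (packing P [] I).support.card := by
    calc 40 * K = ∑ b ∈ (packing P [] I).support, (packing P [] I b).card := by
          rw [sum_card_packing subset_rfl, hI]
      _ ≤ 7 * (packing P [] I).support.card := by
          rw [mul_comm, ← smul_eq_mul]
          exact Finset.sum_le_card_nsmul _ _ 7 fun b _ ↦ hcard b
  have hone := level_one (packing P [] I)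
  have hcount_few := sum_range_seven_le_of_antitone (level_antitone (packing P [] I))
  have hcount_many := four_mul_sum_range_seven_add_le_of_antitone (level_antitone (packing P [] I))
  rw [hcount] at hcount_few hcount_many
  have htiny := card_support_tiny_add_le hP h hI
  have hmedium := level_three_add_level_six_add_le_or (M := 10 * K) (by rwa [← mul_assoc]) h
    (by omega)
  by_contra! hlt
  have htight := four_mul_level_two_add_level_five_le hP h hI (by linarith) (by linarith)
  obtain hmax | hmax := le_total (8 * K) ((packing P [] I).support.card + 2 * K + 3)
  · rw [max_eq_right hmax] at htight
    obtain hfew | ⟨hmany, hmany'⟩ := hmedium <;> linarith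
  · rw [max_eq_left hmax] at htight
    obtain hfew | ⟨hmany, hmany'⟩ := hmedium <;> linarith

theorem KnownOptAlgorithm.le_competitiveRatio (A : KnownOptAlgorithm) {m n C : ℕ} (hn : n ≠ 0)
    (h : ∃ᶠ Q in Filter.atTop, ∃ I, opt I = Q ∧ m * Q ≤ n * A.cost I + C) :
    (m / n : ENNReal) ≤ A.competitiveRatio := by
  have hn0 : (n : ENNReal) ≠ 0 := by exact_mod_cast hn
  refine le_of_forall_lt_imp_le_of_dense fun r hr ↦ ?_
  have hrm : n * r < m := ENNReal.mul_lt_of_lt_div' hr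
  obtain ⟨N, hN⟩ := ENNReal.exists_nat_mul_gt (tsub_pos_of_lt hrm).ne' (ENNReal.natCast_ne_top C)
  refine Filter.le_limsup_of_frequently_le'
    ((h.and_eventually (Filter.eventually_gt_atTop N)).mono ?_)
  rintro Q ⟨⟨I, rfl, hI⟩, hNQ⟩
  have hI' : (m * opt I : ENNReal) ≤ n * A.cost I + C := by exact_mod_cast hI
  have hC : (C : ENNReal) ≤ opt I * (m - n * r) := hN.le.trans (by gcongr)
  have hcost : r * opt I ≤ A.cost I := by
    refine (ENNReal.mul_le_mul_iff_right hn0 (ENNReal.natCast_ne_top n)).1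
      ((ENNReal.add_le_add_iff_right (ENNReal.natCast_ne_top C)).1 ?_)
    calc n * (r * opt I) + C ≤ opt I * (n * r) + opt I * (m - n * r) := by
          rw [show (n : ENNReal) * (r * opt I) = opt I * (n * r) by ring]
          gcongr
      _ = m * opt I := by rw [← mul_add, add_tsub_cancel_of_le hrm.le, mul_comm]
      _ ≤ n * A.cost I + C := hI'
  rw [ENNReal.le_div_iff_mul_le (.inl (by simpa using (N.zero_le.trans_lt hNQ).ne'))
    (.inl (ENNReal.natCast_ne_top _))]
  exact hcost.trans (le_iSup₂ (f := fun (J : Input) (_ : opt J = opt I) ↦ (A.cost J : ENNReal))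
    I rfl)

end BinPacking

theorem theorem2_general (A : BinPacking.KnownOptAlgorithm) :
    (2513 / 1790 : ENNReal) ≤ A.competitiveRatio := by
  refine A.le_competitiveRatio (m := 2513) (n := 1790) (C := 10 ^ 6) (by norm_num)
    (Filter.frequently_atTop.2 fun N ↦ ⟨40 * (N + 100), by omega, ?_⟩)
  by_contra! hcost
  have hP := A.packsWithin_place (c := (2513 * (40 * (N + 100)) - 10 ^ 6 - 1) / 1790)
    fun I hI ↦ by
      have := hcost I hI
      omega
  have := hP.mul_le_mul_add
  omega

theorem theorem2 (A : BinPacking.KnownOptAlgorithm) :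
    (87 / 62 : ENNReal) ≤ A.competitiveRatio :=
  ((ENNReal.toReal_le_toReal (by finiteness) (by finiteness)).1 (by norm_num)).trans
    (theorem2_general A)
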